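/- Let $\mathcal H$ be a complex Hilbert space, $m\ge 0$, and let $Q_{-m},\dots,Q_m$ be bounded operators on $\mathcal H$ such that $Q(z):=\sum_{j=-m}^m Q_j z^j\ge 0$ for all $z\in\mathbb T$. Let $H^2_{\mathcal H}(\mathbb D)$ be the Hardy space of $\mathcal H$-valued functions $f(z)=\sum_{k\ge0}f_kz^k$ with $\|f\|^2=\sum_k\|f_k\|^2<\infty$, identified with $\ell^2_{\mathcal H}(\mathbb N_0)$. An operator polynomial $P(z)=\sum_{j=0}^m P_jz^j$, $P_j\in\mathbf L(\mathcal H)$, is called outer if the multiplication operator $M_P$ on $H^2_{\mathcal H}(\mathbb D)$ has range contained and dense in $H^2_{\mathcal M}(\mathbb D)$ for some closed subspace $\mathcal M\subseteq\mathcal H$. (a) There exists an outer operator polynomial $P(z)=\sum_{j=0}^m P_jz^j$ (of degree at most $m$) with $P_j\in\mathbf L(\mathcal H)$ such that $Q(z)=P(z)^*P(z)$ for all $z\in\mathbb T$. (b) Moreover, such a $P$ can be read off from Schur complements as follows. Let $T_Q=(Q_{i-j})_{i,j\ge0}$ (with $Q_k=0$ for $|k|>m$) be the Toeplitz operator of $Q$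 on $\ell^2_{\mathcal H}(\mathbb N_0)$. For $\Lambda\subseteq\mathbb N_0$, the Schur complement of $T_Q$ supported on $\Lambda$ is the largest operator $S$ with $0\le S\le T_Q$ whose rows and columns outside $\Lambda$ vanish. Let $S(m)$ and $S(m-1)$ be the Schur complements supported on $\{0,\dots,m\}$ and $\{0,\dots,m-1\}$ (so $S(-1)=0$). These exist, and there are $P_0,\dots,P_m\in\mathbf L(\mathcal H)$ with $$S(m)-S(m-1)=\begin{pmatrix}P_m^*\\ \vdots\\ P_0^*\end{pmatrix}\begin{pmatrix}P_m&\cdots&P_0\end{pmatrix}$$ on rows and columns $0,\dots,m$. For every such choice of $P_0,\dots,P_m$, the polynomial $P(z)=\sum_{j=0}^mP_jz^j$ is outer and $Q(z)=P(z)^*P(z)$ for all $z\in\mathbb T$. -/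

import Mathlib

noncomputable section

namespace FejerRiesz

/-- The Hardy space `H²_H(𝔻)` of a complex Hilbert space `H`, in its coefficient model `ℓ²_H(ℕ)`:
the sequence `f` stands for the analytic function `z ↦ ∑ k, z ^ k • f k` on the unit disc
(see `hardyEval`), and `‖f‖ ^ 2 = ∑ k, ‖f k‖ ^ 2`. -/
abbrev Hardy (H : Type*) [NormedAddCommGroup H] : Type _ := lp (fun _ : ℕ => H) 2

variable {H K : Type*} [NormedAddCommGroup H] [InnerProductSpace ℂ H]
  [NormedAddCommGroup K] [InnerProductSpace ℂ K]

/-- The analytic function on the unit disc with the Taylor coefficients `f`. -/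
def hardyEval (f : Hardy H) (z : ℂ) : H := ∑' k, z ^ k • f k

/-- The coefficient sequence of `z ^ k A f(z)` with the negative powers of `z` removed. -/
def shiftFun (A : H →L[ℂ] K) (k : ℤ) (f : ℕ → H) (i : ℕ) : K :=
  if k ≤ i then A (f ((i : ℤ) - k).toNat) else 0

theorem sum_shiftFun_le (A : H →L[ℂ] K) (k : ℤ) (f : Hardy H) (s : Finset ℕ) :
    ∑ i ∈ s, ‖shiftFun A k f i‖ ^ (2 : ENNReal).toReal ≤
      (‖A‖ * ‖f‖) ^ (2 : ENNReal).toReal := by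
  have hinj : Set.InjOn (fun i : ℕ => ((i : ℤ) - k).toNat)
      (s.filter fun i : ℕ => k ≤ (i : ℤ)) := by
    intro a ha b hb hab
    simp only [Finset.coe_filter, Set.mem_ofPred_eq] at ha hb
    have hab' : ((a : ℤ) - k).toNat = ((b : ℤ) - k).toNat := hab
    omega
  have h2 : (0 : ℝ) < (2 : ENNReal).toReal := by norm_num
  calc ∑ i ∈ s, ‖shiftFun A k f i‖ ^ (2 : ENNReal).toReal
      = ∑ i ∈ s.filter (fun i : ℕ => k ≤ (i : ℤ)),
          ‖A (f ((i : ℤ) - k).toNat)‖ ^ (2 : ENNReal).toReal := by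
        rw [Finset.sum_filter]
        refine Finset.sum_congr rfl fun i _ => ?_
        unfold shiftFun
        split_ifs
        · rfl
        · rw [norm_zero, Real.zero_rpow h2.ne']
    _ ≤ ∑ i ∈ s.filter (fun i : ℕ => k ≤ (i : ℤ)),
          ‖A‖ ^ (2 : ENNReal).toReal * ‖f ((i : ℤ) - k).toNat‖ ^ (2 : ENNReal).toReal := by
        refine Finset.sum_le_sum fun i _ => ?_
        rw [← Real.mul_rpow (norm_nonneg _) (norm_nonneg _)]
        exact Real.rpow_le_rpow (norm_nonneg _) (A.le_opNorm _) h2.le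
    _ = ‖A‖ ^ (2 : ENNReal).toReal *
          ∑ j ∈ (s.filter (fun i : ℕ => k ≤ (i : ℤ))).image (fun i : ℕ => ((i : ℤ) - k).toNat),
            ‖f j‖ ^ (2 : ENNReal).toReal := by
        rw [Finset.sum_image hinj, Finset.mul_sum]
    _ ≤ ‖A‖ ^ (2 : ENNReal).toReal * ‖f‖ ^ (2 : ENNReal).toReal :=
        mul_le_mul_of_nonneg_left (lp.sum_rpow_le_norm_rpow h2 f _)
          (Real.rpow_nonneg (norm_nonneg _) _)
    _ = (‖A‖ * ‖f‖) ^ (2 : ENNReal).toReal :=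
        (Real.mul_rpow (norm_nonneg _) (norm_nonneg _)).symm

/-- The bounded operator `f ↦ Π₊ (z ^ k A f)` on the Hardy space, where `Π₊` drops the negative
powers of `z`; it is the Toeplitz operator of the symbol `z ^ k A`. -/
def shiftOp (A : H →L[ℂ] K) (k : ℤ) : Hardy H →L[ℂ] Hardy K :=
  LinearMap.mkContinuous
    { toFun := fun f => ⟨shiftFun A k f, memℓp_gen' (sum_shiftFun_le A k f)⟩
      map_add' := by
        intro f g
        ext i
        change shiftFun A k (f + g : Hardy H) i = shiftFun A k f i + shiftFun A k g i
        unfold shiftFun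
        split_ifs <;> simp
      map_smul' := by
        intro c f
        ext i
        change shiftFun A k (c • f : Hardy H) i = c • shiftFun A k f i
        unfold shiftFun
        split_ifs <;> simp }
    ‖A‖
    (fun f => lp.norm_le_of_forall_sum_le (by norm_num)
      (mul_nonneg (norm_nonneg _) (norm_nonneg _)) (sum_shiftFun_le A k f))

theorem shiftOp_apply (A : H →L[ℂ] K) (k : ℤ) (f : Hardy H) (i : ℕ) :
    shiftOp A k f i = if k ≤ i then A (f ((i : ℤ) - k).toNat) else 0 := rfl

/-- The value `∑_{j = -m}^{m} z ^ j Q_j` of an operator trigonometric polynomial. -/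
def trigEval (m : ℕ) (Q : ℤ → H →L[ℂ] K) (z : ℂ) : H →L[ℂ] K :=
  ∑ j ∈ Finset.Icc (-(m : ℤ)) m, z ^ j • Q j

/-- The Toeplitz operator `T_Q f = Π₊ (Q f)` of `Q(z) = ∑_{j = -m}^{m} z ^ j Q_j`. -/
def toeplitz (m : ℕ) (Q : ℤ → H →L[ℂ] K) : Hardy H →L[ℂ] Hardy K :=
  ∑ j ∈ Finset.Icc (-(m : ℤ)) m, shiftOp (Q j) j

/-- The value `∑_{j = 0}^{m} z ^ j P_j` of an operator polynomial of degree at most `m`. -/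
def polyEval {m : ℕ} (P : Fin (m + 1) → H →L[ℂ] K) (z : ℂ) : H →L[ℂ] K :=
  ∑ j : Fin (m + 1), z ^ (j : ℕ) • P j

/-- The multiplication operator `M_P : H²_H(𝔻) → H²_K(𝔻)`, `(M_P f)(z) = P(z) f(z)`
(see `hardyEval_mulOp`). -/
def mulOp {m : ℕ} (P : Fin (m + 1) → H →L[ℂ] K) : Hardy H →L[ℂ] Hardy K :=
  ∑ j : Fin (m + 1), shiftOp (P j) (j : ℕ)

/-- The subspace `H²_M(𝔻)` of `H²_K(𝔻)`, for a subspace `M` of `K`. -/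
def hardySub (M : Submodule ℂ K) : Submodule ℂ (Hardy K) where
  carrier := {f | ∀ i, f i ∈ M}
  add_mem' hf hg i := M.add_mem (hf i) (hg i)
  zero_mem' _ := M.zero_mem
  smul_mem' c _ hf i := M.smul_mem c (hf i)

/-- An operator polynomial `P` is outer if the range of `M_P` is a dense subspace of `H²_M(𝔻)`
for some closed subspace `M` of `K`. -/
def IsOuter {m : ℕ} (P : Fin (m + 1) → H →L[ℂ] K) : Prop :=
  ∃ M : Submodule ℂ K, IsClosed (M : Set K) ∧
    closure (Set.range (mulOp P)) = (hardySub M : Set (Hardy K))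

/-- The operator `S` on `ℓ²_H(ℕ)` is supported on the rows and columns with index in `Λ`. -/
def SupportedOn (Λ : Set ℕ) (S : Hardy H →L[ℂ] Hardy H) : Prop :=
  (∀ f : Hardy H, ∀ i, i ∉ Λ → S f i = 0) ∧
    ∀ f : Hardy H, (∀ i ∈ Λ, f i = 0) → S f = 0

/-- `S` is the Schur complement of `T ≥ 0` supported on `Λ`, padded with zeros: the largest
operator `0 ≤ S ≤ T` (in the Loewner order) that is supported on the rows and columns in `Λ`. -/
def IsSchurComplement (T : Hardy H →L[ℂ] Hardy H) (Λ : Set ℕ) (S : Hardy H →L[ℂ] Hardy H) :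
    Prop :=
  IsGreatest {S' : Hardy H →L[ℂ] Hardy H | 0 ≤ S' ∧ S' ≤ T ∧ SupportedOn Λ S'} S

/-- The block entry `A i j : H → H` of an operator matrix `A` on `ℓ²_H(ℕ)`. -/
def blockEntry (A : Hardy H →L[ℂ] Hardy H) (i j : ℕ) : H →L[ℂ] H :=
  (lp.evalCLM ℂ (fun _ : ℕ => H) 2 i) ∘L A ∘L
    (lp.singleContinuousLinearMap ℂ (fun _ : ℕ => H) 2 j)

theorem blockEntry_apply (A : Hardy H →L[ℂ] Hardy H) (i j : ℕ) (x : H) :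
    blockEntry A i j x = A (lp.single 2 j x) i := rfl

/-- The operator matrix of `T_Q` is `(Q_{i-j})`, where `Q_k = 0` for `|k| > m`. -/
theorem blockEntry_toeplitz (m : ℕ) (Q : ℤ → H →L[ℂ] H) (i j : ℕ) :
    blockEntry (toeplitz m Q) i j =
      if (i : ℤ) - j ∈ Finset.Icc (-(m : ℤ)) m then Q ((i : ℤ) - j) else 0 := by
  ext x
  have h : ∀ k : ℤ, shiftOp (Q k) k (lp.single 2 j x) i =
      if (i : ℤ) - j = k then Q k x else 0 := by
    intro k
    rw [shiftOp_apply]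
    by_cases hk : (i : ℤ) - j = k
    · have h1 : k ≤ i := by omega
      have h2 : ((i : ℤ) - k).toNat = j := by omega
      rw [if_pos h1, if_pos hk, h2, lp.single_apply_self]
    · rw [if_neg hk]
      split_ifs with h1
      · have h2 : ((i : ℤ) - k).toNat ≠ j := by omega
        rw [lp.single_apply_ne _ _ _ h2, map_zero]
      · rfl
  have hs : toeplitz m Q (lp.single 2 j x) i =
      ∑ k ∈ Finset.Icc (-(m : ℤ)) m, shiftOp (Q k) k (lp.single 2 j x) i := by
    simp only [toeplitz, sum_apply, lp.coeFn_sum]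
    exact Finset.sum_apply _ _ _
  rw [blockEntry_apply, hs, Finset.sum_congr rfl fun k _ => h k, Finset.sum_ite_eq]
  split_ifs <;> rfl

theorem summable_hardyEval [CompleteSpace H] (f : Hardy H) {z : ℂ} (hz : ‖z‖ < 1) :
    Summable fun k => z ^ k • f k := by
  refine Summable.of_norm_bounded (g := fun k => ‖z‖ ^ k * ‖f‖)
    ((summable_geometric_of_lt_one (norm_nonneg z) hz).mul_right _) fun k => ?_
  rw [norm_smul, norm_pow]
  exact mul_le_mul_of_nonneg_left (lp.norm_apply_le_norm (by norm_num) f k)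
    (pow_nonneg (norm_nonneg _) _)

theorem hasSum_shiftOp [CompleteSpace H] (A : H →L[ℂ] K) (k : ℕ) (f : Hardy H)
    {z : ℂ} (hz : ‖z‖ < 1) :
    HasSum (fun i => z ^ i • shiftOp A k f i) (z ^ k • A (hardyEval f z)) := by
  have h0 := ((summable_hardyEval f hz).hasSum.mapL A).const_smul (z ^ k)
  rw [← hasSum_nat_add_iff' k]
  have hz0 : ∑ i ∈ Finset.range k, z ^ i • shiftOp A k f i = 0 := by
    refine Finset.sum_eq_zero fun i hi => ?_
    have hi' : ¬ ((k : ℤ) ≤ i) := by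
      have := Finset.mem_range.1 hi
      omega
    rw [shiftOp_apply, if_neg hi', smul_zero]
  rw [hz0, sub_zero]
  refine h0.congr_fun ?_
  intro i
  have h1 : (k : ℤ) ≤ ((i + k : ℕ) : ℤ) := by omega
  have h2 : (((i + k : ℕ) : ℤ) - k).toNat = i := by omega
  rw [shiftOp_apply, if_pos h1, h2, map_smul, smul_smul, ← pow_add, add_comm k i]

/-- `mulOp P` is multiplication by `P(z)` on the unit disc. -/
theorem hardyEval_mulOp [CompleteSpace H] {m : ℕ} (P : Fin (m + 1) → H →L[ℂ] K)
    (f : Hardy H) {z : ℂ} (hz : ‖z‖ < 1) :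
    hardyEval (mulOp P f) z = polyEval P z (hardyEval f z) := by
  have h := hasSum_sum (s := (Finset.univ : Finset (Fin (m + 1))))
    (fun j _ => hasSum_shiftOp (P j) (j : ℕ) f hz)
  have h1 : ∀ i, ∑ j, z ^ i • shiftOp (P j) ((j : ℕ) : ℤ) f i = z ^ i • mulOp P f i := by
    intro i
    simp only [mulOp, sum_apply, lp.coeFn_sum, ← Finset.smul_sum]
    exact congrArg _ (Finset.sum_apply _ _ _).symm
  have h2 : ∑ j : Fin (m + 1), z ^ (j : ℕ) • P j (hardyEval f z) = polyEval P z (hardyEval f z) := by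
    simp [polyEval, sum_apply]
  rw [← h2]
  simp only [h1] at h
  exact h.tsum_eq

end FejerRiesz

end

/-! Write T for `toeplitz m Q`. Averaging Q(z) ≥ 0 over roots of unity gives T ≥ 0
(`toeplitz_nonneg`). The Schur complement `S n` on {i < n} has as quadratic form at f the infimum of
the form of T over f + z^n H² (`IsShorted`). Let B_n = S (n+1) - S n ≥ 0.

T is shift invariant, so the form of B_{n+k} at z^k f equals that of B_n at f. Since Q has degree at
most m, the forms of `S n` and T agree on polynomials with k coefficients once n ≥ k + m, so B_{m+k}
kills these. Hence B_m determines every B_n: if its form is the squared norm of coefficient m of M_P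
f, then that of B_n is the squared norm of coefficient n (`shorted_sub_eq_norm_sq_apply`). The B_n
telescope, so T = M_P^* M_P (`toeplitz_eq_adjoint_comp`), and comparing entries gives Q = P^* P on
the circle.

The infimum of B_n over f + z^n H² is zero. So any factor of B_m has its range in the closure of its
range on the last coordinate (`mem_closure_range_of_norm_sq_eq`). This lets the P_j take values in H
(`exists_factorization`) and puts ran P_j in the closure of ran P_0. Near-minimizers for `S 1` make
M_P(x + g) close to the constant P_0 x, so P is outer. -/

noncomputable section

namespace FejerRiesz

/-! ### Schur complements as infima of quadratic forms over cosets -/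

section Shorted

variable {E F : Type*} [NormedAddCommGroup E] [InnerProductSpace ℂ E]
  [NormedAddCommGroup F] [InnerProductSpace ℂ F]

open ContinuousLinearMap

local notation "⟪" x ", " y "⟫" => inner ℂ x y

theorem exists_inner_eq_of_nonneg [CompleteSpace E] {A : E →L[ℂ] E} (hA : 0 ≤ A) :
    ∃ R : E →L[ℂ] E, ∀ f g, ⟪A f, g⟫ = ⟪R f, R g⟫ := by
  obtain ⟨R, rfl⟩ := CStarAlgebra.nonneg_iff_eq_star_mul_self.1 hA
  exact ⟨R, fun f g => by
    exact adjoint_inner_left R g (R f)⟩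

theorem reApplyInnerSelf_nonneg {A : E →L[ℂ] E} (hA : 0 ≤ A) (f : E) :
    0 ≤ A.reApplyInnerSelf f :=
  ((nonneg_iff_isPositive A).1 hA).2 f

theorem reApplyInnerSelf_sub (A B : E →L[ℂ] E) (f : E) :
    (A - B).reApplyInnerSelf f = A.reApplyInnerSelf f - B.reApplyInnerSelf f := by
  simp [reApplyInnerSelf_apply, inner_sub_left]

theorem reApplyInnerSelf_mono {A B : E →L[ℂ] E} (h : A ≤ B) (f : E) :
    A.reApplyInnerSelf f ≤ B.reApplyInnerSelf f := by
  have := ((le_def A B).1 h).2 f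
  rw [reApplyInnerSelf_sub] at this
  linarith

theorem le_of_reApplyInnerSelf_le {A B : E →L[ℂ] E} (hA : 0 ≤ A) (hB : 0 ≤ B)
    (h : ∀ f, A.reApplyInnerSelf f ≤ B.reApplyInnerSelf f) : A ≤ B := by
  rw [le_def]
  refine ⟨(((nonneg_iff_isPositive B).1 hB).1).sub ((nonneg_iff_isPositive A).1 hA).1, fun f => ?_⟩
  rw [reApplyInnerSelf_sub]
  linarith [h f]

theorem reApplyInnerSelf_add_of_map_eq_zero {A : E →L[ℂ] E} (hA : 0 ≤ A) (f : E) {g : E}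
    (hg : A g = 0) : A.reApplyInnerSelf (f + g) = A.reApplyInnerSelf f := by
  have h : ⟪A f, g⟫ = ⟪f, A g⟫ := ((nonneg_iff_isPositive A).1 hA).1 f g
  simp only [reApplyInnerSelf_apply, map_add, hg, add_zero, inner_add_right, h, inner_zero_right]

theorem map_eq_zero_of_reApplyInnerSelf_eq_zero [CompleteSpace E] {A : E →L[ℂ] E} (hA : 0 ≤ A)
    {f : E} (hf : A.reApplyInnerSelf f = 0) : A f = 0 := by
  obtain ⟨R, hR⟩ := exists_inner_eq_of_nonneg hA
  have h : R f = 0 := by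
    rw [reApplyInnerSelf_apply, hR, inner_self_eq_norm_sq] at hf
    simpa using hf
  exact ext_inner_right ℂ fun g => by rw [hR, h, inner_zero_left, inner_zero_left]

/-- `S` is the Schur complement of `T ≥ 0` that compresses out the subspace `L`: its quadratic form
at `f` is the infimum of the quadratic form of `T` over `f + L`. -/
structure IsShorted (T : E →L[ℂ] E) (L : Submodule ℂ E) (S : E →L[ℂ] E) : Prop where
  nonneg : 0 ≤ S
  le : S ≤ T
  map_eq_zero : ∀ g ∈ L, S g = 0
  exists_lt : ∀ (f : E) (ε : ℝ), 0 < ε →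
    ∃ g ∈ L, T.reApplyInnerSelf (f + g) < S.reApplyInnerSelf f + ε

namespace IsShorted

theorem reApplyInnerSelf_add {T S : E →L[ℂ] E} {L : Submodule ℂ E} (h : IsShorted T L S)
    (f : E) {g : E} (hg : g ∈ L) : S.reApplyInnerSelf (f + g) = S.reApplyInnerSelf f :=
  reApplyInnerSelf_add_of_map_eq_zero h.nonneg f (h.map_eq_zero g hg)

theorem reApplyInnerSelf_le {T S : E →L[ℂ] E} {L : Submodule ℂ E} (h : IsShorted T L S)
    (f : E) {g : E} (hg : g ∈ L) : S.reApplyInnerSelf f ≤ T.reApplyInnerSelf (f + g) := by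
  rw [← h.reApplyInnerSelf_add f hg]
  exact reApplyInnerSelf_mono h.le _

theorem le_of_map_eq_zero {T S S' : E →L[ℂ] E} {L : Submodule ℂ E} (h : IsShorted T L S)
    (h0 : 0 ≤ S') (hT : S' ≤ T) (hL : ∀ g ∈ L, S' g = 0) : S' ≤ S := by
  refine le_of_reApplyInnerSelf_le h0 h.nonneg fun f => le_of_forall_pos_le_add fun ε hε => ?_
  obtain ⟨g, hg, hlt⟩ := h.exists_lt f ε hε
  rw [← reApplyInnerSelf_add_of_map_eq_zero h0 f (hL g hg)]
  exact (reApplyInnerSelf_mono hT _).trans hlt.le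

end IsShorted

/-- With T = R^* R, the infimum at f is the squared distance from Rf to the closure K of R(L). It is
attained by the projection onto Kᗮ, which gives S = p^* p. -/
theorem exists_isShorted [CompleteSpace E] {T : E →L[ℂ] E} (hT : 0 ≤ T) (L : Submodule ℂ E) :
    ∃ S, IsShorted T L S := by
  obtain ⟨R, hR⟩ := exists_inner_eq_of_nonneg hT
  have hTq : ∀ f, T.reApplyInnerSelf f = ‖R f‖ ^ 2 := fun f => by
    rw [reApplyInnerSelf_apply, hR, inner_self_eq_norm_sq]
  set K : Submodule ℂ E := (L.map (R : E →ₗ[ℂ] E)).topologicalClosure with hK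
  have hKc : IsClosed (K : Set E) := Submodule.isClosed_topologicalClosure _
  have : CompleteSpace K := hKc.completeSpace_coe
  set p : E →L[ℂ] E := Kᗮ.starProjection ∘L R with hp
  have hpq : ∀ f, (adjoint p ∘L p).reApplyInnerSelf f = ‖p f‖ ^ 2 := fun f => by
    rw [reApplyInnerSelf_apply, comp_apply, adjoint_inner_left, inner_self_eq_norm_sq]
  have hpos : 0 ≤ adjoint p ∘L p := (nonneg_iff_isPositive _).2 (isPositive_adjoint_comp_self p)
  refine ⟨adjoint p ∘L p, hpos, le_of_reApplyInnerSelf_le hpos hT fun f => ?_, fun g hg => ?_,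
    fun f ε hε => ?_⟩
  · rw [hpq, hTq]
    exact pow_le_pow_left₀ (norm_nonneg _) (Submodule.norm_starProjection_apply_le _ _) 2
  · have : R g ∈ K := Submodule.le_topologicalClosure _ ⟨g, hg, rfl⟩
    have h0 : p g = 0 := by
      rw [hp, comp_apply, Submodule.starProjection_apply_eq_zero_iff]
      exact Submodule.le_orthogonal_orthogonal K this
    rw [comp_apply, h0, map_zero]
  · have hdec : R f = K.starProjection (R f) + p f :=
      (Submodule.starProjection_add_starProjection_orthogonal (K := K) (R f)).symm
    have hmem : -K.starProjection (R f) ∈ closure (R '' (L : Set E)) := by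
      have := K.neg_mem (Submodule.starProjection_apply_mem K (R f))
      exact this
    have hcont : Continuous fun v => ‖R f + v‖ ^ 2 := by fun_prop
    have hval : ‖R f + -K.starProjection (R f)‖ ^ 2 = ‖p f‖ ^ 2 := by
      congr 2
      nth_rewrite 1 [hdec]
      abel
    have hopen : {v | ‖R f + v‖ ^ 2 < ‖p f‖ ^ 2 + ε} ∈ nhds (-K.starProjection (R f)) :=
      (isOpen_lt hcont continuous_const).mem_nhds (by
        rw [Set.mem_ofPred_eq, hval]; linarith)
    obtain ⟨v, hv, g, hg, rfl⟩ := mem_closure_iff_nhds.1 hmem _ hopen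
    refine ⟨g, hg, ?_⟩
    rw [hTq, hpq, map_add]
    exact hv

/-- The isometric factor of the polar decomposition. -/
theorem exists_linearIsometry_closure_range [CompleteSpace E] [CompleteSpace F] (Y : E →L[ℂ] F) :
    Nonempty ((LinearMap.range (Y : E →ₗ[ℂ] F)).topologicalClosure →ₗᵢ[ℂ] E) := by
  -- A^* A = Y^* Y gives ‖A x‖ = ‖Y x‖, so Y x ↦ A x is well defined and isometric, and extends to
  -- the closure.
  obtain ⟨A, hA⟩ := exists_inner_eq_of_nonneg
    ((nonneg_iff_isPositive _).2 (isPositive_adjoint_comp_self Y))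
  have hn : ∀ x, ‖A x‖ = ‖Y x‖ := fun x => by
    have := hA x x
    rw [comp_apply, adjoint_inner_left, inner_self_eq_norm_sq_to_K, inner_self_eq_norm_sq_to_K]
      at this
    have h2 : ‖Y x‖ ^ 2 = ‖A x‖ ^ 2 := by exact_mod_cast this
    exact ((sq_eq_sq₀ (norm_nonneg _) (norm_nonneg _)).1 h2).symm
  set K := (LinearMap.range (Y : E →ₗ[ℂ] F)).topologicalClosure with hK
  have hmem : ∀ x, (Y : E →ₗ[ℂ] F) x ∈ K := fun x => Submodule.le_topologicalClosure _ ⟨x, rfl⟩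
  set e : E →ₗ[ℂ] K := (Y : E →ₗ[ℂ] F).codRestrict K hmem with he
  have hen : ∀ x, ‖e x‖ = ‖Y x‖ := fun x => rfl
  have hd : DenseRange e := by
    intro y
    rw [closure_subtype]
    have : Subtype.val '' Set.range e = (LinearMap.range (Y : E →ₗ[ℂ] F) : Set F) := by
      ext z
      constructor
      · rintro ⟨_, ⟨x, rfl⟩, rfl⟩
        exact ⟨x, rfl⟩
      · rintro ⟨x, rfl⟩
        exact ⟨e x, ⟨x, rfl⟩, rfl⟩
    rw [this]
    exact y.2
  set U := (A : E →ₗ[ℂ] E).extendOfNorm e with hU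
  have hUe : ∀ x, U (e x) = A x := fun x =>
    LinearMap.extendOfNorm_eq hd ⟨1, fun x => by
      rw [one_mul, hen]; exact (hn x).le⟩ x
  refine ⟨⟨U, fun y => ?_⟩⟩
  refine hd.induction_on (p := fun y => ‖U y‖ = ‖y‖) y
    (isClosed_eq (by fun_prop) (by fun_prop)) fun x => ?_
  rw [hUe, hen, hn]

end Shorted

variable {H K : Type*} [NormedAddCommGroup H] [InnerProductSpace ℂ H]
  [NormedAddCommGroup K] [InnerProductSpace ℂ K]

open ContinuousLinearMap Filter Topology

local notation "⟪" x ", " y "⟫" => inner ℂ x y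

/-! ### Shifts, truncations and tails in coordinates -/

section Coordinates

theorem coe_sum_apply {ι : Type*} (s : Finset ι) (f : ι → Hardy H) (i : ℕ) :
    (∑ k ∈ s, f k) i = ∑ k ∈ s, f k i := by
  rw [lp.coeFn_sum, Finset.sum_apply]

theorem toeplitz_apply (m : ℕ) (Q : ℤ → H →L[ℂ] K) (f : Hardy H) (i : ℕ) :
    toeplitz m Q f i = ∑ k ∈ Finset.Icc (-(m : ℤ)) m,
      if k ≤ i then Q k (f ((i : ℤ) - k).toNat) else 0 := by
  simp only [toeplitz, sum_apply, coe_sum_apply, shiftOp_apply]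

theorem mulOp_apply {m : ℕ} (P : Fin (m + 1) → H →L[ℂ] K) (f : Hardy H) (i : ℕ) :
    mulOp P f i = ∑ j : Fin (m + 1), if (j : ℕ) ≤ i then P j (f (i - j)) else 0 := by
  simp only [mulOp, sum_apply, coe_sum_apply, shiftOp_apply, Nat.cast_le]
  refine Finset.sum_congr rfl fun j _ => ?_
  split_ifs with h
  · have : ((i : ℤ) - (j : ℕ)).toNat = i - j := by omega
    rw [this]
  · rfl

/-- Multiplication by `z ^ k`. -/
def shiftFwd (k : ℕ) : Hardy H →L[ℂ] Hardy H := shiftOp (ContinuousLinearMap.id ℂ H) k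

/-- Division by `z ^ k`, dropping the negative powers. -/
def shiftBwd (k : ℕ) : Hardy H →L[ℂ] Hardy H := shiftOp (ContinuousLinearMap.id ℂ H) (-k)

theorem shiftFwd_apply (k : ℕ) (f : Hardy H) (i : ℕ) :
    shiftFwd k f i = if k ≤ i then f (i - k) else 0 := by
  rw [shiftFwd, shiftOp_apply]
  simp only [Nat.cast_le, id_apply]
  split_ifs with h
  · exact congrArg (fun n => f n) (by omega)
  · rfl

theorem shiftFwd_apply_add (k : ℕ) (f : Hardy H) (i : ℕ) : shiftFwd k f (i + k) = f i := by
  rw [shiftFwd_apply, if_pos (Nat.le_add_left k i), Nat.add_sub_cancel]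

theorem shiftBwd_apply (k : ℕ) (f : Hardy H) (i : ℕ) : shiftBwd k f i = f (i + k) := by
  rw [shiftBwd, shiftOp_apply, if_pos (by omega), id_apply]
  exact congrArg (fun n => f n) (by omega)

theorem inner_shiftFwd_right (k : ℕ) (f g : Hardy H) :
    ⟪g, shiftFwd k f⟫ = ⟪shiftBwd k g, f⟫ := by
  have h0 : ∑ i ∈ Finset.range k, ⟪g i, shiftFwd k f i⟫ = 0 := by
    refine Finset.sum_eq_zero fun i hi => ?_
    rw [shiftFwd_apply, if_neg (by simpa using hi), inner_zero_right]
  have h1 := (lp.summable_inner (𝕜 := ℂ) g (shiftFwd k f)).sum_add_tsum_nat_add k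
  rw [h0, zero_add] at h1
  rw [lp.inner_eq_tsum, lp.inner_eq_tsum, ← h1]
  simp only [shiftFwd_apply_add, shiftBwd_apply]

/-- Entries depend only on i - j, so deleting the first k rows and columns changes nothing. -/
theorem shiftBwd_toeplitz_shiftFwd (m : ℕ) (Q : ℤ → H →L[ℂ] H) (k : ℕ) (f : Hardy H) :
    shiftBwd k (toeplitz m Q (shiftFwd k f)) = toeplitz m Q f := by
  ext i
  rw [shiftBwd_apply, toeplitz_apply, toeplitz_apply]
  refine Finset.sum_congr rfl fun j _ => ?_
  rw [shiftFwd_apply]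
  by_cases h : j ≤ (i : ℤ)
  · rw [if_pos h, if_pos (by omega), if_pos (by omega)]
    exact congrArg (fun n => Q j (f n)) (by omega)
  · rw [if_neg h]
    split_ifs
    · omega
    · exact map_zero _
    · rfl

theorem reApplyInnerSelf_toeplitz_shiftFwd (m : ℕ) (Q : ℤ → H →L[ℂ] H) (k : ℕ) (f : Hardy H) :
    (toeplitz m Q).reApplyInnerSelf (shiftFwd k f) = (toeplitz m Q).reApplyInnerSelf f := by
  rw [reApplyInnerSelf_apply, reApplyInnerSelf_apply, inner_shiftFwd_right,
    shiftBwd_toeplitz_shiftFwd]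

theorem mulOp_shiftFwd {m : ℕ} (P : Fin (m + 1) → H →L[ℂ] K) (k : ℕ) (f : Hardy H) :
    mulOp P (shiftFwd k f) = shiftFwd k (mulOp P f) := by
  ext i
  rw [shiftFwd_apply, mulOp_apply]
  split_ifs with hk
  · rw [mulOp_apply]
    refine Finset.sum_congr rfl fun j _ => ?_
    rw [shiftFwd_apply]
    by_cases h : (j : ℕ) ≤ i - k
    · rw [if_pos h, if_pos (by omega), if_pos (by omega)]
      exact congrArg (fun n => P j (f n)) (by omega)
    · rw [if_neg h]
      split_ifs
      · omega
      · exact map_zero _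
      · rfl
  · refine Finset.sum_eq_zero fun j _ => ?_
    split_ifs
    · rw [shiftFwd_apply, if_neg (by omega), map_zero]
    · rfl

/-- Coefficient m + k of the product involves only f_k, …, f_{m+k}, all kept by the backward shift.
Coefficients below m would lose terms. -/
theorem mulOp_shiftBwd_apply {m : ℕ} (P : Fin (m + 1) → H →L[ℂ] K) (k : ℕ) (f : Hardy H) :
    mulOp P (shiftBwd k f) m = mulOp P f (m + k) := by
  rw [mulOp_apply, mulOp_apply]
  refine Finset.sum_congr rfl fun j _ => ?_
  have := j.2
  rw [if_pos (by omega), if_pos (by omega), shiftBwd_apply]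
  exact congrArg (fun n => P j (f n)) (by omega)

theorem toeplitz_apply_eq_zero (m : ℕ) (Q : ℤ → H →L[ℂ] K) {k : ℕ} {f : Hardy H}
    (hf : ∀ i, k ≤ i → f i = 0) {i : ℕ} (hi : k + m ≤ i) : toeplitz m Q f i = 0 := by
  rw [toeplitz_apply]
  refine Finset.sum_eq_zero fun j hj => ?_
  rw [Finset.mem_Icc] at hj
  rw [hf _ (by omega), map_zero, ite_self]

theorem mulOp_apply_eq_zero {m : ℕ} (P : Fin (m + 1) → H →L[ℂ] K) {k : ℕ} {f : Hardy H}
    (hf : ∀ i, k ≤ i → f i = 0) {i : ℕ} (hi : k + m ≤ i) : mulOp P f i = 0 := by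
  rw [mulOp_apply]
  refine Finset.sum_eq_zero fun j _ => ?_
  have := j.2
  rw [hf _ (by omega), map_zero, ite_self]

/-- The truncation of a sequence to its first `n` terms. -/
def trunc (n : ℕ) (f : Hardy H) : Hardy H := ∑ i ∈ Finset.range n, lp.single 2 i (f i)

theorem trunc_apply (n : ℕ) (f : Hardy H) (i : ℕ) :
    trunc n f i = if i < n then f i else 0 := by
  rw [trunc, coe_sum_apply]
  have : ∀ k, (lp.single 2 k (f k) : Hardy H) i = if i = k then f i else 0 := by
    intro k
    split_ifs with h
    · subst h; rw [lp.single_apply_self]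
    · rw [lp.single_apply_ne _ _ _ h]
  simp only [this, Finset.sum_ite_eq, Finset.mem_range]

theorem trunc_apply_of_le {n : ℕ} (f : Hardy H) {i : ℕ} (h : n ≤ i) : trunc n f i = 0 := by
  rw [trunc_apply, if_neg (by omega)]

theorem tendsto_trunc (f : Hardy H) : Tendsto (fun n => trunc n f) atTop (𝓝 f) :=
  (lp.hasSum_single (by norm_num) f).tendsto_sum_nat

/-- The sequences whose first `n` terms vanish, that is, the multiples of `z ^ n`. -/
def tailSub (H : Type*) [NormedAddCommGroup H] [InnerProductSpace ℂ H] (n : ℕ) :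
    Submodule ℂ (Hardy H) where
  carrier := {f | ∀ i, i < n → f i = 0}
  add_mem' hf hg i hi := by
    rw [lp.coeFn_add, Pi.add_apply, hf i hi, hg i hi, add_zero]
  zero_mem' _ _ := rfl
  smul_mem' c f hf i hi := by
    rw [lp.coeFn_smul, Pi.smul_apply, hf i hi, smul_zero]

theorem tailSub_anti {n k : ℕ} (h : n ≤ k) : tailSub H k ≤ tailSub H n :=
  fun _ hf i hi => hf i (hi.trans_le h)

theorem shiftFwd_mem_tailSub {n : ℕ} {f : Hardy H} (hf : f ∈ tailSub H n) (k : ℕ) :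
    shiftFwd k f ∈ tailSub H (n + k) := by
  intro i hi
  rw [shiftFwd_apply]
  split_ifs with h
  · exact hf _ (by omega)
  · rfl

theorem shiftBwd_mem_tailSub {n k : ℕ} {f : Hardy H} (hf : f ∈ tailSub H (n + k)) :
    shiftBwd k f ∈ tailSub H n := fun i hi => by
  rw [shiftBwd_apply]; exact hf _ (by omega)

theorem shiftFwd_shiftBwd {k : ℕ} {f : Hardy H} (hf : f ∈ tailSub H k) :
    shiftFwd k (shiftBwd k f) = f := by
  ext i
  rw [shiftFwd_apply]
  split_ifs with h
  · rw [shiftBwd_apply, Nat.sub_add_cancel h]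
  · exact (hf i (by omega)).symm

theorem sub_trunc_mem_tailSub (n : ℕ) (f : Hardy H) : f - trunc n f ∈ tailSub H n := by
  intro i hi
  rw [lp.coeFn_sub, Pi.sub_apply, trunc_apply, if_pos hi, sub_self]

theorem shiftFwd_shiftBwd_eq_sub_trunc (k : ℕ) (f : Hardy H) :
    shiftFwd k (shiftBwd k f) = f - trunc k f := by
  ext i
  rw [shiftFwd_apply, lp.coeFn_sub, Pi.sub_apply, trunc_apply]
  split_ifs with h h' h'
  · omega
  · rw [shiftBwd_apply, Nat.sub_add_cancel h, sub_zero]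
  · rw [sub_self]
  · omega

theorem inner_eq_sum {n : ℕ} (g : Hardy H) {f : Hardy H} (hf : ∀ i, n ≤ i → f i = 0) :
    ⟪g, f⟫ = ∑ i ∈ Finset.range n, ⟪g i, f i⟫ := by
  rw [lp.inner_eq_tsum]
  exact tsum_eq_sum fun i hi => by rw [hf i (by simpa using hi), inner_zero_right]

end Coordinates

/-! ### Positivity of the Toeplitz operator -/

section Positivity

theorem sum_primitiveRoot_zpow {N : ℕ} {ζ : ℂ} (hζ : IsPrimitiveRoot ζ N) {d : ℤ}
    (hd : |d| < N) : ∑ t ∈ Finset.range N, (ζ ^ t) ^ d = if d = 0 then (N : ℂ) else 0 := by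
  have hcomm : ∀ t : ℕ, (ζ ^ t) ^ d = (ζ ^ d) ^ t := fun t => by
    rw [← zpow_natCast, ← zpow_natCast, ← zpow_mul, ← zpow_mul, mul_comm]
  simp only [hcomm]
  split_ifs with h
  · simp [h]
  · have h1 : ζ ^ d ≠ 1 := fun h1 => h <|
      Int.eq_zero_of_abs_lt_dvd ((hζ.zpow_eq_one_iff_dvd d).1 h1) hd
    rw [geom_sum_eq h1, ← hcomm, hζ.pow_eq_one, one_zpow, sub_self, zero_div]

open ComplexOrder

/-- For a polynomial f, the form of T is the mean over the circle of the forms of Q(z) at f(z). The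
mean over the N-th roots of unity is already exact for trigonometric polynomials of degree below N.
-/
theorem inner_toeplitz_nonneg_of_finite [CompleteSpace H] {m : ℕ} {Q : ℤ → H →L[ℂ] H}
    (hQ : ∀ z : ℂ, ‖z‖ = 1 → 0 ≤ trigEval m Q z) {n : ℕ} {f : Hardy H}
    (hf : ∀ i, n ≤ i → f i = 0) : 0 ≤ ⟪toeplitz m Q f, f⟫ := by
  -- The exponents a - k - b below have absolute value at most n - 1 + m.
  set N := n + m + 1 with hN
  have hN0 : N ≠ 0 := by omega
  set ζ : ℂ := Complex.exp (2 * Real.pi * Complex.I / N) with hζ'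
  have hζ : IsPrimitiveRoot ζ N := Complex.isPrimitiveRoot_exp N hN0
  have hnorm : ∀ t : ℕ, ‖ζ ^ t‖ = 1 := fun t => by
    rw [norm_pow, hζ.norm'_eq_one hN0, one_pow]
  set F : ℕ → H := fun t => ∑ b ∈ Finset.range n, (ζ ^ t) ^ b • f b with hF
  have hpos : ∀ t, 0 ≤ ⟪trigEval m Q (ζ ^ t) (F t), F t⟫ := fun t =>
    ((nonneg_iff_isPositive _).1 (hQ _ (hnorm t))).inner_nonneg_left (F t)
  have hexp : ∀ t, ⟪trigEval m Q (ζ ^ t) (F t), F t⟫ =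
      ∑ k ∈ Finset.Icc (-(m : ℤ)) m, ∑ b ∈ Finset.range n, ∑ a ∈ Finset.range n,
        (ζ ^ t) ^ ((a : ℤ) - k - b) * ⟪Q k (f b), f a⟫ := by
    intro t
    have hz : (ζ ^ t) ≠ 0 := fun h => by simpa [h] using hnorm t
    have hconj : (starRingEnd ℂ) (ζ ^ t) = (ζ ^ t)⁻¹ := by
      rw [Complex.inv_def, Complex.normSq_eq_norm_sq, hnorm t]; simp
    simp only [trigEval, sum_apply, smul_apply, sum_inner, hF, map_sum, inner_sum,
      Finset.smul_sum, map_smul, inner_smul_left, inner_smul_right]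
    simp only [Finset.mul_sum]
    rw [Finset.sum_comm]
    conv_rhs => rw [Finset.sum_comm]
    refine Finset.sum_congr rfl fun b _ => ?_
    rw [Finset.sum_comm]
    refine Finset.sum_congr rfl fun k _ => Finset.sum_congr rfl fun a _ => ?_
    rw [map_zpow₀, map_pow, hconj, zpow_sub₀ hz, zpow_sub₀ hz, inv_zpow, zpow_natCast,
      zpow_natCast, inv_pow]
    field_simp
  have hT : ⟪toeplitz m Q f, f⟫ = ∑ k ∈ Finset.Icc (-(m : ℤ)) m, ∑ b ∈ Finset.range n,
      ∑ a ∈ Finset.range n, if (a : ℤ) - k - b = 0 then ⟪Q k (f b), f a⟫ else 0 := by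
    rw [inner_eq_sum _ hf]
    simp only [toeplitz_apply, sum_inner]
    rw [Finset.sum_comm]
    refine Finset.sum_congr rfl fun k _ => ?_
    rw [Finset.sum_comm]
    refine Finset.sum_congr rfl fun a ha => ?_
    split_ifs with h
    · by_cases hb : ((a : ℤ) - k).toNat < n
      · rw [Finset.sum_eq_single_of_mem _ (Finset.mem_range.2 hb), if_pos (by omega)]
        intro b _ hne
        rw [if_neg (by omega)]
      · rw [hf _ (not_lt.1 hb), map_zero, inner_zero_left, Finset.sum_eq_zero]
        intro b hb'
        rw [Finset.mem_range] at hb'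
        rw [if_neg (by omega)]
    · rw [inner_zero_left, Finset.sum_eq_zero]
      intro b _
      rw [if_neg (by omega)]
  have hsum : ∑ t ∈ Finset.range N, ⟪trigEval m Q (ζ ^ t) (F t), F t⟫ =
      N * ⟪toeplitz m Q f, f⟫ := by
    rw [Finset.sum_congr rfl fun t _ => hexp t, hT, Finset.sum_comm, Finset.mul_sum]
    refine Finset.sum_congr rfl fun k hk => ?_
    rw [Finset.sum_comm, Finset.mul_sum]
    refine Finset.sum_congr rfl fun b hb => ?_
    rw [Finset.sum_comm, Finset.mul_sum]
    refine Finset.sum_congr rfl fun a ha => ?_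
    rw [Finset.mem_Icc] at hk
    rw [Finset.mem_range] at ha hb
    rw [← Finset.sum_mul, sum_primitiveRoot_zpow hζ (by rw [abs_lt]; omega)]
    split_ifs
    · rfl
    · rw [zero_mul, mul_zero]
  have h1 : 0 ≤ (N : ℂ) * ⟪toeplitz m Q f, f⟫ := hsum ▸ Finset.sum_nonneg fun t _ => hpos t
  have h2 : ⟪toeplitz m Q f, f⟫ = ((N : ℝ)⁻¹ : ℝ) * ((N : ℂ) * ⟪toeplitz m Q f, f⟫) := by
    push_cast
    rw [inv_mul_cancel_left₀ (Nat.cast_ne_zero.2 hN0)]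
  rw [h2]
  exact mul_nonneg (Complex.zero_le_real.2 (by positivity)) h1

theorem toeplitz_nonneg [CompleteSpace H] {m : ℕ} {Q : ℤ → H →L[ℂ] H}
    (hQ : ∀ z : ℂ, ‖z‖ = 1 → 0 ≤ trigEval m Q z) : 0 ≤ toeplitz m Q := by
  rw [nonneg_iff_isPositive, isPositive_iff_complex]
  intro f
  have hlim : Tendsto (fun n => ⟪toeplitz m Q (trunc n f), trunc n f⟫) atTop
      (𝓝 ⟪toeplitz m Q f, f⟫) :=
    (((toeplitz m Q).continuous.tendsto f).comp (tendsto_trunc f)).inner (tendsto_trunc f)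
  have h : 0 ≤ ⟪toeplitz m Q f, f⟫ := ge_of_tendsto' hlim fun n =>
    inner_toeplitz_nonneg_of_finite hQ (n := n) fun i hi => trunc_apply_of_le f hi
  rw [Complex.nonneg_iff] at h
  refine ⟨?_, h.1⟩
  apply Complex.ext
  · simp
  · simpa using h.2

end Positivity

/-! ### Increments of the Schur complements and the factorization of T -/

section ShortedToeplitz

variable {m : ℕ} {Q : ℤ → H →L[ℂ] H}

/-- Multiplication by z^k maps the coset f + z^n H² onto z^k f + z^(n+k) H² and preserves the form
of T, so the infima agree. -/
theorem IsShorted.reApplyInnerSelf_shiftFwd {n k : ℕ} {A B : Hardy H →L[ℂ] Hardy H}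
    (hA : IsShorted (toeplitz m Q) (tailSub H n) A)
    (hB : IsShorted (toeplitz m Q) (tailSub H (n + k)) B) (f : Hardy H) :
    B.reApplyInnerSelf (shiftFwd k f) = A.reApplyInnerSelf f := by
  refine le_antisymm (le_of_forall_pos_le_add fun ε hε => ?_)
    (le_of_forall_pos_le_add fun ε hε => ?_)
  · obtain ⟨g, hg, hlt⟩ := hA.exists_lt f ε hε
    have h := hB.reApplyInnerSelf_le (shiftFwd k f) (shiftFwd_mem_tailSub hg k)
    rw [← map_add, reApplyInnerSelf_toeplitz_shiftFwd] at h
    exact h.trans hlt.le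
  · obtain ⟨g, hg, hlt⟩ := hB.exists_lt (shiftFwd k f) ε hε
    rw [← shiftFwd_shiftBwd (tailSub_anti (Nat.le_add_left k n) hg), ← map_add,
      reApplyInnerSelf_toeplitz_shiftFwd] at hlt
    exact (hA.reApplyInnerSelf_le f (shiftBwd_mem_tailSub hg)).trans hlt.le

/-- T f vanishes from index k + m on, so it is orthogonal to the tail. Adding g to f then adds only
the form of T at g, which is nonnegative. -/
theorem IsShorted.reApplyInnerSelf_of_finite {n k : ℕ} {A : Hardy H →L[ℂ] Hardy H}
    (hT : 0 ≤ toeplitz m Q) (hA : IsShorted (toeplitz m Q) (tailSub H n) A) (hn : k + m ≤ n)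
    {f : Hardy H} (hf : ∀ i, k ≤ i → f i = 0) :
    A.reApplyInnerSelf f = (toeplitz m Q).reApplyInnerSelf f := by
  refine le_antisymm (reApplyInnerSelf_mono hA.le f) (le_of_forall_pos_le_add fun ε hε => ?_)
  obtain ⟨g, hg, hlt⟩ := hA.exists_lt f ε hε
  refine le_trans ?_ hlt.le
  have h1 : ⟪toeplitz m Q f, g⟫ = 0 := by
    rw [lp.inner_eq_tsum]
    refine (tsum_congr fun i => ?_).trans tsum_zero
    rcases lt_or_ge i n with hi | hi
    · rw [hg i hi, inner_zero_right]
    · rw [toeplitz_apply_eq_zero m Q hf (hn.trans hi), inner_zero_left]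
  have h2 : ⟪toeplitz m Q g, f⟫ = 0 := by
    have : ⟪toeplitz m Q g, f⟫ = ⟪g, toeplitz m Q f⟫ := ((nonneg_iff_isPositive _).1 hT).1 g f
    rw [this, ← inner_conj_symm, h1, map_zero]
  have h3 := reApplyInnerSelf_nonneg hT g
  rw [reApplyInnerSelf_apply] at h3
  simp only [reApplyInnerSelf_apply, map_add, inner_add_left, inner_add_right, h1, h2, map_zero]
  linarith

theorem inner_apply_single (A : Hardy H →L[ℂ] Hardy H) (i j : ℕ) (x y : H) :
    ⟪A (lp.single 2 j x), lp.single 2 i y⟫ = ⟪blockEntry A i j x, y⟫ := by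
  rw [blockEntry_apply, ← inner_conj_symm, lp.inner_single_left, inner_conj_symm]

theorem IsShorted.isSchurComplement {n : ℕ} {T A : Hardy H →L[ℂ] Hardy H}
    (hA : IsShorted T (tailSub H n) A) : IsSchurComplement T {i | i < n} A := by
  refine ⟨⟨hA.nonneg, hA.le, fun f i hi => ?_, fun f hf => hA.map_eq_zero f hf⟩, ?_⟩
  -- Columns outside the support vanish by `map_eq_zero`; symmetry of A transfers this to rows.
  · refine ext_inner_right ℂ fun y => ?_
    have h1 : ⟪A f, lp.single 2 i y⟫ = ⟪f, A (lp.single 2 i y)⟫ :=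
      ((nonneg_iff_isPositive _).1 hA.nonneg).1 f _
    have h2 : A (lp.single 2 i y) = 0 := hA.map_eq_zero _ fun k hk =>
      lp.single_apply_ne _ _ _ fun h => hi (h ▸ hk)
    rw [h2, inner_zero_right] at h1
    have h3 : ⟪lp.single 2 i y, A f⟫ = ⟪y, A f i⟫ := lp.inner_single_left i y (A f)
    rw [inner_zero_left, ← inner_conj_symm, ← h3, inner_conj_symm, h1]
  · rintro S' ⟨h0, hT, hs⟩
    exact hA.le_of_map_eq_zero h0 hT fun g hg => hs.2 g hg

variable {S : ℕ → Hardy H →L[ℂ] Hardy H}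
  (hS : ∀ n, IsShorted (toeplitz m Q) (tailSub H n) (S n))

include hS

theorem shorted_sub_nonneg (n : ℕ) : 0 ≤ S (n + 1) - S n :=
  (nonneg_iff_isPositive _).2 <| (le_def _ _).1 <| (hS (n + 1)).le_of_map_eq_zero (hS n).nonneg (hS n).le fun g hg =>
    (hS n).map_eq_zero g (tailSub_anti (Nat.le_succ n) hg)

theorem shorted_sub_map_eq_zero (n : ℕ) {g : Hardy H} (hg : g ∈ tailSub H (n + 1)) :
    (S (n + 1) - S n) g = 0 := by
  rw [sub_apply, (hS _).map_eq_zero g hg,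
    (hS n).map_eq_zero g (tailSub_anti (Nat.le_succ n) hg), sub_zero]

/-- A near-minimizer g for `S n` works, because `S (n + 1)` ≤ T and the form of `S n` is constant on
the coset. -/
theorem exists_shorted_sub_lt (n : ℕ) (f : Hardy H) {ε : ℝ} (hε : 0 < ε) :
    ∃ g ∈ tailSub H n, (S (n + 1) - S n).reApplyInnerSelf (f + g) < ε := by
  obtain ⟨g, hg, hlt⟩ := (hS n).exists_lt f ε hε
  refine ⟨g, hg, ?_⟩
  rw [reApplyInnerSelf_sub, (hS n).reApplyInnerSelf_add f hg]
  linarith [reApplyInnerSelf_mono (hS (n + 1)).le (f + g)]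

/-- Some g in the tail makes Φ(f + g) small, and Φ g depends only on g_n because the increment kills
the next tail. So Φ f is close to the image of -g_n in slot n. -/
theorem mem_closure_range_of_norm_sq_eq (n : ℕ) (Φ : Hardy H →L[ℂ] K)
    (hΦ : ∀ f, (S (n + 1) - S n).reApplyInnerSelf f = ‖Φ f‖ ^ 2) (f : Hardy H) :
    Φ f ∈ closure (Set.range fun x : H => Φ (lp.single 2 n x)) := by
  rw [Metric.mem_closure_iff]
  intro ε hε
  obtain ⟨g, hg, hlt⟩ := exists_shorted_sub_lt hS n f (pow_pos hε 2)
  refine ⟨_, ⟨-g n, rfl⟩, ?_⟩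
  have hg' : g - lp.single 2 n (g n) ∈ tailSub H (n + 1) := by
    intro i hi
    rw [lp.coeFn_sub, Pi.sub_apply]
    rcases (Nat.lt_succ_iff.1 hi).lt_or_eq with h | rfl
    · rw [hg i h, lp.single_apply_ne _ _ _ h.ne, sub_zero]
    · rw [lp.single_apply_self, sub_self]
  have h0 : Φ (g - lp.single 2 n (g n)) = 0 := by
    have := hΦ (g - lp.single 2 n (g n))
    rw [reApplyInnerSelf_apply, shorted_sub_map_eq_zero hS n hg', inner_zero_left, map_zero]
      at this
    simpa using this.symm
  rw [map_sub, sub_eq_zero] at h0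
  change dist (Φ f) (Φ (lp.single 2 n (-g n))) < ε
  rw [lp.single_neg, map_neg, ← h0, dist_eq_norm, sub_neg_eq_add, ← map_add]
  rw [hΦ] at hlt
  exact lt_of_pow_lt_pow_left₀ 2 hε.le hlt

theorem exists_factorization [CompleteSpace H] :
    ∃ P : Fin (m + 1) → H →L[ℂ] H, ∀ i j : Fin (m + 1),
      blockEntry (S (m + 1) - S m) i j = adjoint (P i.rev) ∘L P j.rev := by
  obtain ⟨R, hR⟩ := exists_inner_eq_of_nonneg (shorted_sub_nonneg hS m)
  -- R has values in the Hardy space, but its range lies in the closure of the range of its column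
  -- m. That column starts from H, so the closure embeds isometrically in H.
  set Y : H →L[ℂ] Hardy H := R ∘L lp.singleContinuousLinearMap ℂ (fun _ : ℕ => H) 2 m with hY
  obtain ⟨U⟩ := exists_linearIsometry_closure_range Y
  have hmem : ∀ f, R f ∈ (LinearMap.range (Y : H →ₗ[ℂ] Hardy H)).topologicalClosure := fun f =>
    mem_closure_range_of_norm_sq_eq hS m R (fun f => by
      rw [reApplyInnerSelf_apply, hR, inner_self_eq_norm_sq]) f
  refine ⟨fun j => U.toContinuousLinearMap ∘L
    (R ∘L lp.singleContinuousLinearMap ℂ (fun _ : ℕ => H) 2 (m - j)).codRestrict _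
      (fun x => hmem _), fun i j => ?_⟩
  have hrev : ∀ i : Fin (m + 1), m - (i.rev : ℕ) = i := fun i => by
    have := i.2
    rw [Fin.val_rev]; omega
  ext x
  refine ext_inner_right ℂ fun y => ?_
  rw [← inner_apply_single, hR, comp_apply, adjoint_inner_left]
  simp only [comp_apply, LinearIsometry.coe_toContinuousLinearMap, LinearIsometry.inner_map_map,
    hrev]
  rfl

theorem sum_reApplyInnerSelf_shorted_sub (N : ℕ) (f : Hardy H) :
    ∑ n ∈ Finset.range N, (S (n + 1) - S n).reApplyInnerSelf f = (S N).reApplyInnerSelf f := by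
  simp only [reApplyInnerSelf_sub]
  rw [Finset.sum_range_sub fun n => (S n).reApplyInnerSelf f, reApplyInnerSelf_apply (S 0),
    (hS 0).map_eq_zero f fun i hi => absurd hi (Nat.not_lt_zero i), inner_zero_left, map_zero,
    sub_zero]

variable [CompleteSpace H] {P : Fin (m + 1) → H →L[ℂ] H}
  (hP : ∀ i j : Fin (m + 1), blockEntry (S (m + 1) - S m) i j = adjoint (P i.rev) ∘L P j.rev)

include hP

theorem shorted_sub_eq_norm_sq (f : Hardy H) :
    (S (m + 1) - S m).reApplyInnerSelf f = ‖mulOp P f m‖ ^ 2 := by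
  set B := S (m + 1) - S m with hB
  have hM : mulOp P f m = ∑ b : Fin (m + 1), P b.rev (f b) := by
    rw [mulOp_apply, ← Equiv.sum_comp Fin.revPerm]
    refine Finset.sum_congr rfl fun b _ => ?_
    have := b.2
    rw [Fin.revPerm_apply, if_pos (by omega)]
    exact congrArg (fun n => P b.rev (f n)) (by rw [Fin.val_rev]; omega)
  -- The increment ignores coefficients beyond m, so the blocks given by `hP` determine its form.
  have htr : B.reApplyInnerSelf f = B.reApplyInnerSelf (trunc (m + 1) f) := by
    rw [← reApplyInnerSelf_add_of_map_eq_zero (shorted_sub_nonneg hS m) (trunc (m + 1) f)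
      (shorted_sub_map_eq_zero hS m (sub_trunc_mem_tailSub (m + 1) f)), add_sub_cancel]
  have hin : ⟪B (trunc (m + 1) f), trunc (m + 1) f⟫ = ⟪mulOp P f m, mulOp P f m⟫ := by
    rw [hM]
    simp only [trunc, map_sum, sum_inner, inner_sum, inner_apply_single, Finset.sum_range, hP,
      comp_apply, adjoint_inner_left]
  rw [htr, reApplyInnerSelf_apply, hin, inner_self_eq_norm_sq]

/-- For n ≤ m, shift f forward to reach level m. For n = m + k, the increment kills the first k
coefficients of f, and what remains is a forward shift by k. -/
theorem shorted_sub_eq_norm_sq_apply (hT : 0 ≤ toeplitz m Q) (n : ℕ) (f : Hardy H) :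
    (S (n + 1) - S n).reApplyInnerSelf f = ‖mulOp P f n‖ ^ 2 := by
  rcases le_total n m with h | h
  · obtain ⟨k, rfl⟩ := Nat.exists_eq_add_of_le h
    have h1 := shorted_sub_eq_norm_sq hS hP (shiftFwd k f)
    have hS' : IsShorted (toeplitz (n + k) Q) (tailSub H (n + 1 + k)) (S (n + k + 1)) := by
      rw [Nat.add_right_comm]; exact hS _
    rw [mulOp_shiftFwd, shiftFwd_apply_add, reApplyInnerSelf_sub,
      (hS (n + 1)).reApplyInnerSelf_shiftFwd hS', (hS n).reApplyInnerSelf_shiftFwd (hS (n + k)),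
      ← reApplyInnerSelf_sub] at h1
    exact h1
  · obtain ⟨k, rfl⟩ := Nat.exists_eq_add_of_le h
    have hS' : IsShorted (toeplitz m Q) (tailSub H (m + 1 + k)) (S (m + k + 1)) := by
      rw [Nat.add_right_comm]; exact hS _
    have hz : (S (m + k + 1) - S (m + k)) (trunc k f) = 0 := by
      refine map_eq_zero_of_reApplyInnerSelf_eq_zero (shorted_sub_nonneg hS _) ?_
      have hf : ∀ i, k ≤ i → trunc k f i = 0 := fun i hi => trunc_apply_of_le f hi
      rw [reApplyInnerSelf_sub, (hS _).reApplyInnerSelf_of_finite hT (by omega) hf,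
        (hS _).reApplyInnerSelf_of_finite hT (by omega) hf, sub_self]
    have h1 := shorted_sub_eq_norm_sq hS hP (shiftBwd k f)
    rw [reApplyInnerSelf_sub, ← (hS (m + 1)).reApplyInnerSelf_shiftFwd hS',
      ← (hS m).reApplyInnerSelf_shiftFwd (hS (m + k)), ← reApplyInnerSelf_sub,
      shiftFwd_shiftBwd_eq_sub_trunc, mulOp_shiftBwd_apply,
      ← reApplyInnerSelf_add_of_map_eq_zero (shorted_sub_nonneg hS _) _ hz, sub_add_cancel] at h1
    exact h1

theorem reApplyInnerSelf_toeplitz_eq_norm_sq (hT : 0 ≤ toeplitz m Q) (f : Hardy H) :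
    (toeplitz m Q).reApplyInnerSelf f = ‖mulOp P f‖ ^ 2 := by
  have hfin : ∀ k, (toeplitz m Q).reApplyInnerSelf (trunc k f) = ‖mulOp P (trunc k f)‖ ^ 2 := by
    intro k
    have hf : ∀ i, k ≤ i → trunc k f i = 0 := fun i hi => trunc_apply_of_le f hi
    rw [← (hS (k + m)).reApplyInnerSelf_of_finite hT le_rfl hf,
      ← sum_reApplyInnerSelf_shorted_sub hS, ← inner_self_eq_norm_sq (𝕜 := ℂ),
      inner_eq_sum (n := k + m) _ fun i hi => mulOp_apply_eq_zero P hf hi, map_sum]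
    refine Finset.sum_congr rfl fun n _ => ?_
    rw [shorted_sub_eq_norm_sq_apply hS hP hT, inner_self_eq_norm_sq]
  have h1 : Tendsto (fun k => (toeplitz m Q).reApplyInnerSelf (trunc k f)) atTop
      (𝓝 ((toeplitz m Q).reApplyInnerSelf f)) :=
    ((toeplitz m Q).reApplyInnerSelf_continuous.tendsto f).comp (tendsto_trunc f)
  have h2 : Tendsto (fun k => ‖mulOp P (trunc k f)‖ ^ 2) atTop (𝓝 (‖mulOp P f‖ ^ 2)) :=
    ((((mulOp P).continuous.tendsto f).comp (tendsto_trunc f)).norm).pow 2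
  exact tendsto_nhds_unique h1 (h2.congr fun k => (hfin k).symm)

theorem toeplitz_eq_adjoint_comp (hT : 0 ≤ toeplitz m Q) :
    toeplitz m Q = adjoint (mulOp P) ∘L mulOp P := by
  have h0 : 0 ≤ adjoint (mulOp P) ∘L mulOp P :=
    (nonneg_iff_isPositive _).2 (isPositive_adjoint_comp_self _)
  have h : ∀ f, (adjoint (mulOp P) ∘L mulOp P).reApplyInnerSelf f =
      (toeplitz m Q).reApplyInnerSelf f := fun f => by
    rw [reApplyInnerSelf_toeplitz_eq_norm_sq hS hP hT, reApplyInnerSelf_apply, comp_apply,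
      adjoint_inner_left, inner_self_eq_norm_sq]
  exact le_antisymm (le_of_reApplyInnerSelf_le hT h0 fun f => (h f).ge)
    (le_of_reApplyInnerSelf_le h0 hT fun f => (h f).le)

end ShortedToeplitz

/-! ### From T = M_P^* M_P to Q = P^* P on the circle -/

section Factorization

theorem mulOp_single {m : ℕ} (P : Fin (m + 1) → H →L[ℂ] K) (b : ℕ) (x : H) :
    mulOp P (lp.single 2 b x) = ∑ j : Fin (m + 1), lp.single 2 (b + j) (P j x) := by
  ext i
  rw [mulOp_apply, coe_sum_apply]
  refine Finset.sum_congr rfl fun j _ => ?_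
  by_cases h : i = b + j
  · subst h
    rw [if_pos (Nat.le_add_left _ _), Nat.add_sub_cancel, lp.single_apply_self,
      lp.single_apply_self]
  · rw [lp.single_apply_ne _ _ _ h]
    split_ifs
    · rw [lp.single_apply_ne _ _ _ (by omega), map_zero]
    · rfl

theorem trigEval_eq_of_toeplitz_eq [CompleteSpace H] {m : ℕ} {Q : ℤ → H →L[ℂ] H}
    {P : Fin (m + 1) → H →L[ℂ] H} (h : toeplitz m Q = adjoint (mulOp P) ∘L mulOp P)
    {z : ℂ} (hz : ‖z‖ = 1) :
    trigEval m Q z = adjoint (polyEval P z) ∘L polyEval P z := by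
  have hcoef : ∀ k ∈ Finset.Icc (-(m : ℤ)) m, ∀ x y : H, ⟪Q k x, y⟫ =
      ∑ i : Fin (m + 1), ∑ j : Fin (m + 1),
        if k = (i : ℤ) - (j : ℕ) then ⟪P i x, P j y⟫ else 0 := by
    intro k hk x y
    have hk' := Finset.mem_Icc.1 hk
    -- Column m contains every Q_k with |k| ≤ m, since the row m + k is never negative.
    have hQk : blockEntry (toeplitz m Q) (m + k).toNat m = Q k := by
      have : (((m + k).toNat : ℕ) : ℤ) - m = k := by omega
      rw [blockEntry_toeplitz, this, if_pos hk]
    rw [← hQk, ← inner_apply_single, h, comp_apply, adjoint_inner_left, mulOp_single,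
      mulOp_single, sum_inner]
    refine Finset.sum_congr rfl fun i _ => ?_
    rw [inner_sum]
    refine Finset.sum_congr rfl fun j _ => ?_
    rw [lp.inner_single_left]
    split_ifs with hij
    · have : m + (i : ℕ) = (m + k).toNat + j := by omega
      rw [this, lp.single_apply_self]
    · rw [lp.single_apply_ne _ _ _ (by omega), inner_zero_right]
  have hz0 : z ≠ 0 := fun h0 => by simp [h0] at hz
  have hconj : (starRingEnd ℂ) z = z⁻¹ := by
    rw [Complex.inv_def, Complex.normSq_eq_norm_sq, hz]; simp
  ext x
  refine ext_inner_right ℂ fun y => ?_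
  rw [comp_apply, adjoint_inner_left]
  simp only [trigEval, polyEval, sum_apply, smul_apply, sum_inner, inner_sum, inner_smul_left,
    inner_smul_right]
  rw [Finset.sum_congr rfl fun k hk => by rw [hcoef k hk x y]]
  simp only [Finset.mul_sum]
  rw [Finset.sum_comm]
  conv_rhs => rw [Finset.sum_comm]
  refine Finset.sum_congr rfl fun i _ => ?_
  rw [Finset.sum_comm]
  refine Finset.sum_congr rfl fun j _ => ?_
  have hi := i.2
  have hj := j.2
  rw [Finset.sum_eq_single_of_mem ((i : ℤ) - (j : ℕ)) (Finset.mem_Icc.2 (by omega)), if_pos rfl]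
  · rw [map_zpow₀, map_pow, hconj, zpow_sub₀ (inv_ne_zero hz0), zpow_natCast, zpow_natCast,
      inv_pow, inv_pow]
    field_simp
  · intro k _ hne
    rw [if_neg hne, mul_zero]

end Factorization

/-! ### Outerness -/

section Outer

theorem shiftFwd_single (n : ℕ) (x : H) :
    shiftFwd n (lp.single 2 0 x : Hardy H) = lp.single 2 n x := by
  ext i
  rw [shiftFwd_apply]
  by_cases h : i = n
  · subst h
    rw [if_pos le_rfl, Nat.sub_self, lp.single_apply_self, lp.single_apply_self]
  · rw [lp.single_apply_ne _ _ _ h]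
    split_ifs
    · exact lp.single_apply_ne _ _ _ (by omega)
    · rfl

/-- M is the closure of ran P_0. The closure of ran M_P is shift invariant, so it contains z^n y for
all y in M once it contains the constants P_0 x; truncation then gives all of H²_M. -/
theorem isOuter_of_forall [CompleteSpace H] {m : ℕ} {P : Fin (m + 1) → H →L[ℂ] K}
    (hmem : ∀ j x, P j x ∈ closure (Set.range (P 0)))
    (happ : ∀ x, lp.single 2 0 (P 0 x) ∈ closure (Set.range (mulOp P))) : IsOuter P := by
  set M : Submodule ℂ K := (LinearMap.range (P 0 : H →ₗ[ℂ] K)).topologicalClosure with hM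
  have hMc : IsClosed (M : Set K) := Submodule.isClosed_topologicalClosure _
  set C : Submodule ℂ (Hardy K) :=
    (LinearMap.range (mulOp P : Hardy H →ₗ[ℂ] Hardy K)).topologicalClosure with hC
  have hCc : IsClosed (C : Set (Hardy K)) := Submodule.isClosed_topologicalClosure _
  have hshift : ∀ n f, f ∈ C → shiftFwd n f ∈ C := by
    intro n f hf
    refine map_mem_closure (shiftFwd n).continuous hf ?_
    rintro _ ⟨g, rfl⟩
    exact ⟨shiftFwd n g, mulOp_shiftFwd P n g⟩
  have hsingle : ∀ n, ∀ y ∈ M, (lp.single 2 n y : Hardy K) ∈ C := by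
    intro n y hy
    rw [← SetLike.mem_coe, ← hCc.closure_eq]
    refine map_mem_closure (lp.singleContinuousLinearMap ℂ (fun _ : ℕ => K) 2 n).continuous hy ?_
    rintro _ ⟨x, rfl⟩
    have h := hshift n _ (happ x)
    rwa [shiftFwd_single] at h
  refine ⟨M, hMc, Set.Subset.antisymm (closure_minimal ?_ ?_) fun f hf => ?_⟩
  · rintro _ ⟨f, rfl⟩ i
    rw [mulOp_apply]
    refine M.sum_mem fun j _ => ?_
    split_ifs
    · exact hmem j _
    · exact M.zero_mem
  · have : (hardySub M : Set (Hardy K)) = ⋂ i, {f | f i ∈ M} := by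
      ext f; simp only [Set.mem_iInter]; rfl
    rw [this]
    exact isClosed_iInter fun i =>
      hMc.preimage (lp.evalCLM ℂ (fun _ : ℕ => K) 2 i).continuous
  · exact hCc.mem_of_tendsto (tendsto_trunc f)
      (Eventually.of_forall fun n => C.sum_mem fun i _ => hsingle i _ (hf i))

theorem isOuter_of_shorted [CompleteSpace H] {m : ℕ} {Q : ℤ → H →L[ℂ] H}
    {S : ℕ → Hardy H →L[ℂ] Hardy H} {P : Fin (m + 1) → H →L[ℂ] H} (hT : 0 ≤ toeplitz m Q)
    (hS : ∀ n, IsShorted (toeplitz m Q) (tailSub H n) (S n))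
    (hP : ∀ i j : Fin (m + 1),
      blockEntry (S (m + 1) - S m) i j = adjoint (P i.rev) ∘L P j.rev) : IsOuter P := by
  have hval : ∀ (j : Fin (m + 1)) x, mulOp P (lp.single 2 (m - j) x) m = P j x := by
    intro j x
    have := j.2
    rw [mulOp_apply, Finset.sum_eq_single_of_mem j (Finset.mem_univ _), if_pos (by omega),
      lp.single_apply_self]
    intro k _ hk
    have hk' : (k : ℕ) ≠ j := fun h => hk (Fin.ext h)
    have := k.2
    rw [lp.single_apply_ne _ _ _ (by omega), map_zero, ite_self]
  refine isOuter_of_forall (fun j x => ?_) fun x => ?_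
  · have h := mem_closure_range_of_norm_sq_eq hS m
      (lp.evalCLM ℂ (fun _ : ℕ => H) 2 m ∘L mulOp P)
      (fun f => shorted_sub_eq_norm_sq hS hP f) (lp.single 2 (m - j) x)
    have h0 : (fun x : H => (lp.evalCLM ℂ (fun _ : ℕ => H) 2 m ∘L mulOp P) (lp.single 2 m x)) =
        P 0 := funext fun x => hval 0 x
    rw [h0] at h
    have h1 := hval j x
    rw [← h1]
    exact h
  · rw [Metric.mem_closure_iff]
    intro ε hε
    obtain ⟨g, hg, hlt⟩ := (hS 1).exists_lt (lp.single 2 0 x) (ε ^ 2) (pow_pos hε 2)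
    refine ⟨_, ⟨lp.single 2 0 x + g, rfl⟩, ?_⟩
    set v := mulOp P (lp.single 2 0 x + g) with hv
    have hv0 : v 0 = P 0 x := by
      rw [hv, mulOp_apply, Finset.sum_eq_single_of_mem 0 (Finset.mem_univ _),
        if_pos (by simp : ((0 : Fin (m + 1)) : ℕ) ≤ 0)]
      · change P 0 ((lp.single 2 0 x + g : Hardy H) 0) = P 0 x
        rw [lp.coeFn_add, Pi.add_apply, hg _ (by simp)]
        simp
      · intro j _ hj
        rw [if_neg]
        intro h
        exact hj (Fin.ext (Nat.le_zero.1 h))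
    -- `S 0` = 0, so the form of `S 1` is that of the increment at 0, whose value here is ‖P 0 x‖ ^
    -- 2.
    have hn : ‖v‖ ^ 2 < ‖P 0 x‖ ^ 2 + ε ^ 2 := by
      have h1 := shorted_sub_eq_norm_sq_apply hS hP hT 0 (lp.single 2 0 x + g)
      rw [← hv, hv0, zero_add, reApplyInnerSelf_sub, (hS 1).reApplyInnerSelf_add _ hg,
        reApplyInnerSelf_apply (S 0), (hS 0).map_eq_zero _ fun i hi => absurd hi (by simp),
        inner_zero_left, map_zero, sub_zero] at h1
      rwa [← reApplyInnerSelf_toeplitz_eq_norm_sq hS hP hT, ← h1]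
    have hin : ⟪(lp.single 2 0 (P 0 x) : Hardy H), v⟫ = ⟪P 0 x, P 0 x⟫ := by
      rw [lp.inner_single_left, hv0]
    -- v has zeroth coefficient P 0 x, so by Pythagoras this is ‖v‖ ^ 2 - ‖P 0 x‖ ^ 2.
    have hd : ‖lp.single 2 0 (P 0 x) - v‖ ^ 2 < ε ^ 2 := by
      rw [norm_sub_sq (𝕜 := ℂ), hin, inner_self_eq_norm_sq, lp.norm_single (by norm_num)]
      linarith
    rw [dist_eq_norm]
    exact lt_of_pow_lt_pow_left₀ 2 hε.le hd

end Outer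

end FejerRiesz

end

theorem mainTheorem3 {H : Type*} [NormedAddCommGroup H] [InnerProductSpace ℂ H] [CompleteSpace H]
    (m : ℕ) (Q : ℤ → H →L[ℂ] H)
    (hQ : ∀ z : ℂ, ‖z‖ = 1 → 0 ≤ FejerRiesz.trigEval m Q z) :
    (∃ P : Fin (m + 1) → H →L[ℂ] H, FejerRiesz.IsOuter P ∧
      ∀ z : ℂ, ‖z‖ = 1 → FejerRiesz.trigEval m Q z =
        ContinuousLinearMap.adjoint (FejerRiesz.polyEval P z) ∘L FejerRiesz.polyEval P z) ∧
    ∃ S S' : FejerRiesz.Hardy H →L[ℂ] FejerRiesz.Hardy H,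
      FejerRiesz.IsSchurComplement (FejerRiesz.toeplitz m Q) {i | i ≤ m} S ∧
      FejerRiesz.IsSchurComplement (FejerRiesz.toeplitz m Q) {i | i < m} S' ∧
      (∃ P : Fin (m + 1) → H →L[ℂ] H, ∀ i j : Fin (m + 1),
        FejerRiesz.blockEntry (S - S') i j =
          ContinuousLinearMap.adjoint (P i.rev) ∘L P j.rev) ∧
      ∀ P : Fin (m + 1) → H →L[ℂ] H,
        (∀ i j : Fin (m + 1), FejerRiesz.blockEntry (S - S') i j =
          ContinuousLinearMap.adjoint (P i.rev) ∘L P j.rev) →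
        FejerRiesz.IsOuter P ∧
        ∀ z : ℂ, ‖z‖ = 1 → FejerRiesz.trigEval m Q z =
          ContinuousLinearMap.adjoint (FejerRiesz.polyEval P z) ∘L FejerRiesz.polyEval P z := by
  have hT := FejerRiesz.toeplitz_nonneg hQ
  -- `S n` lives on {i < n}: the S(m) and S(m-1) of the statement are `S (m + 1)` and `S m`.
  choose S hS using fun n => FejerRiesz.exists_isShorted hT (FejerRiesz.tailSub H n)
  have hle : {i | i ≤ m} = {i | i < m + 1} := Set.ext fun i => Nat.lt_succ_iff.symm
  have hmain : ∀ P : Fin (m + 1) → H →L[ℂ] H,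
      (∀ i j : Fin (m + 1), FejerRiesz.blockEntry (S (m + 1) - S m) i j =
        ContinuousLinearMap.adjoint (P i.rev) ∘L P j.rev) →
      FejerRiesz.IsOuter P ∧
      ∀ z : ℂ, ‖z‖ = 1 → FejerRiesz.trigEval m Q z =
        ContinuousLinearMap.adjoint (FejerRiesz.polyEval P z) ∘L FejerRiesz.polyEval P z :=
    fun P hP => ⟨FejerRiesz.isOuter_of_shorted hT hS hP, fun z hz =>
      FejerRiesz.trigEval_eq_of_toeplitz_eq
        (FejerRiesz.toeplitz_eq_adjoint_comp hS hP hT) hz⟩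
  obtain ⟨P, hP⟩ := FejerRiesz.exists_factorization hS
  exact ⟨⟨P, hmain P hP⟩, S (m + 1), S m, hle ▸ (hS (m + 1)).isSchurComplement,
    (hS m).isSchurComplement, ⟨P, hP⟩, hmain⟩
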